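/- For an integer $n\ge 1$ let $T_n$ be the $(n+1)$-regular tree with a preferred end and a preferred vertex $o$, and let $b:V(T_n)\to\mathbf Z$ be the associated Busemann function, $b(x)=d(x,c)-d(o,c)$, where $c$ is the vertex at which the rays from $x$ and from $o$ to the preferred end merge. The Diestel–Leader graph $\mathrm{DL}(m,n)$ has the vertex set $\{(x,y)\in V(T_m)\times V(T_n): b(x)+b(y)=0\}$, and $(x,y)$, $(x',y')$ are adjacent if $x,x'$ are adjacent in $T_m$ and $y,y'$ are adjacent in $T_n$. Its vertex set is given the discrete topology. **Proposition.** Let $m,n\ge 2$, and let $\Gamma$ be a locally compact group that acts continuously, properly and cocompactly by graph automorphisms (equivalently, by isometries) on $\mathrm{DL}(m,n)$. Then there is an integer $d\ge 1$ such that $\Gamma$ itself admits a continuous, proper action by graph automorphisms on $\mathrm{DL}(m^d,n^d)$ that is transitive on the vertices. -/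

import Mathlib

namespace DiestelLeader

/-- The vertices of the `(n + 1)`-regular tree `T_n` with a preferred end `-∞` (for `n ≥ 1`).
A vertex of height `k` is the sequence of labels in `{0, …, n - 1}` of the edges of the ray that
comes up from the end `-∞` to the vertex: the edge from height `i` to height `i + 1` has the
label `digit i`, for `i < k`, and these labels vanish far down. The values of `digit` at
`i ≥ k` carry no information and are normalised to `0`. -/
@[ext]
structure Tree (n : ℕ) where
  height : ℤ
  digit : ℤ → ℕ
  digit_lt : ∀ i, i < height → digit i < n
  digit_eq_zero : ∀ i, height ≤ i → digit i = 0
  exists_forall_lt : ∃ N : ℤ, ∀ i, i < N → digit i = 0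

namespace Tree

/-- The neighbour of `x` in the direction of the end `-∞`: forget the last edge. -/
def parent {n : ℕ} (x : Tree n) : Tree n where
  height := x.height - 1
  digit i := if i < x.height - 1 then x.digit i else 0
  digit_lt i hi := by
    rw [if_pos hi]
    exact x.digit_lt i (by omega)
  digit_eq_zero i hi := if_neg (by omega)
  exists_forall_lt := by
    obtain ⟨N, hN⟩ := x.exists_forall_lt
    refine ⟨N, fun i hi => ?_⟩
    split_ifs
    · exact hN i hi
    · rfl

/-- The tree `T_n`: every vertex is joined to its parent. -/
def graph (n : ℕ) : SimpleGraph (Tree n) where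
  Adj x y := parent x = y ∨ parent y = x
  symm := ⟨fun _ _ h => h.symm⟩
  loopless := ⟨fun x h => by
    have h1 : (parent x).height = x.height := by
      rcases h with h | h <;> rw [h]
    have h2 : (parent x).height = x.height - 1 := rfl
    omega⟩

/-- The preferred vertex `o`, of height `0`. -/
def origin (n : ℕ) (hn : 0 < n) : Tree n where
  height := 0
  digit _ := 0
  digit_lt _ _ := hn
  digit_eq_zero _ _ := rfl
  exists_forall_lt := ⟨0, fun _ _ => rfl⟩

/-- The vertices of the ray from `x` to the end `-∞`. -/
def ray {n : ℕ} (x : Tree n) : Set (Tree n) := Set.range fun k : ℕ => parent^[k] x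

/-- The child of `x` with label `j`. -/
def child {n : ℕ} (x : Tree n) (j : Fin n) : Tree n where
  height := x.height + 1
  digit i := if i = x.height then j else x.digit i
  digit_lt i hi := by
    split_ifs with h
    · exact j.2
    · exact x.digit_lt i (by omega)
  digit_eq_zero i hi := by
    rw [if_neg (by omega)]
    exact x.digit_eq_zero i (by omega)
  exists_forall_lt := by
    obtain ⟨N, hN⟩ := x.exists_forall_lt
    refine ⟨min N x.height, fun i hi => ?_⟩
    rw [if_neg (by omega)]
    exact hN i (by omega)

theorem height_parent {n : ℕ} (x : Tree n) : (parent x).height = x.height - 1 := rfl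

theorem height_iterate {n : ℕ} (x : Tree n) (k : ℕ) :
    (parent^[k] x).height = x.height - k := by
  induction k with
  | zero => simp
  | succ k ih =>
    rw [Function.iterate_succ_apply', height_parent, ih]
    push_cast
    ring

theorem digit_iterate {n : ℕ} (x : Tree n) (k : ℕ) (i : ℤ) :
    (parent^[k] x).digit i = if i < x.height - k then x.digit i else 0 := by
  induction k with
  | zero =>
    simp only [Function.iterate_zero, id_eq, Nat.cast_zero, sub_zero]
    split_ifs with h
    · rfl
    · exact x.digit_eq_zero i (by omega)
  | succ k ih =>
    rw [Function.iterate_succ_apply']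
    change (if i < (parent^[k] x).height - 1 then (parent^[k] x).digit i else 0) = _
    rw [ih, height_iterate]
    push_cast
    split_ifs <;> first | rfl | omega

theorem parent_child {n : ℕ} (x : Tree n) (j : Fin n) : parent (child x j) = x := by
  refine Tree.ext ?_ (funext fun i => ?_)
  · simp [parent, child]
  · simp only [parent, child, add_sub_cancel_right]
    split_ifs with h1 h2
    · omega
    · rfl
    · exact (x.digit_eq_zero i (by omega)).symm

theorem child_injective {n : ℕ} (x : Tree n) : Function.Injective (child x) := by
  intro j k h
  have h1 := congrFun (congrArg Tree.digit h) x.height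
  simpa [child, Fin.ext_iff] using h1

theorem exists_child_eq {n : ℕ} (x y : Tree n) (h : parent y = x) : ∃ j, child x j = y := by
  subst h
  refine ⟨⟨y.digit (y.height - 1), y.digit_lt _ (by omega)⟩,
    Tree.ext (by simp [parent, child]) (funext fun i => ?_)⟩
  change (if i = y.height - 1 then y.digit (y.height - 1)
    else if i < y.height - 1 then y.digit i else 0) = y.digit i
  by_cases h1 : i = y.height - 1
  · rw [if_pos h1, h1]
  · rw [if_neg h1]
    by_cases h2 : i < y.height - 1
    · rw [if_pos h2]
    · rw [if_neg h2]
      exact (y.digit_eq_zero i (by omega)).symm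

theorem adj_parent {n : ℕ} (x : Tree n) : (graph n).Adj x (parent x) := Or.inl rfl

/-- Any two rays to `-∞` meet. -/
theorem exists_iterate_eq {n : ℕ} (x y : Tree n) :
    ∃ k l : ℕ, parent^[k] x = parent^[l] y := by
  obtain ⟨N, hN⟩ := x.exists_forall_lt
  obtain ⟨M, hM⟩ := y.exists_forall_lt
  let h := min (min N M) (min x.height y.height)
  refine ⟨(x.height - h).toNat, (y.height - h).toNat, Tree.ext ?_ (funext fun i => ?_)⟩
  · rw [height_iterate, height_iterate]
    omega
  · rw [digit_iterate, digit_iterate]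
    split_ifs with h1 h2 h2
    · rw [hN i (by omega), hM i (by omega)]
    · exact hN i (by omega)
    · exact (hM i (by omega)).symm
    · rfl

theorem exists_walk_iterate {n : ℕ} (x : Tree n) (k : ℕ) :
    ∃ p : (graph n).Walk x (parent^[k] x), p.length = k := by
  induction k generalizing x with
  | zero => exact ⟨.nil, rfl⟩
  | succ k ih =>
    obtain ⟨p, hp⟩ := ih (parent x)
    rw [Function.iterate_succ_apply]
    exact ⟨.cons (adj_parent x) p, by rw [SimpleGraph.Walk.length_cons, hp]⟩

theorem height_le_of_walk {n : ℕ} {x y : Tree n} (p : (graph n).Walk x y) :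
    x.height ≤ y.height + p.length := by
  induction p with
  | nil => simp
  | cons h p ih =>
    rw [SimpleGraph.Walk.length_cons]
    rcases h with h | h <;>
    · have := congrArg Tree.height h
      rw [height_parent] at this
      push_cast
      omega

theorem connected {n : ℕ} (hn : 0 < n) : (graph n).Connected := by
  have : Nonempty (Tree n) := ⟨origin n hn⟩
  refine ⟨fun x y => ?_⟩
  obtain ⟨k, l, h⟩ := exists_iterate_eq x y
  obtain ⟨p, -⟩ := exists_walk_iterate x k
  obtain ⟨q, -⟩ := exists_walk_iterate y l
  rw [h] at p
  exact ⟨p.append q.reverse⟩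

/-- `T_n` is a tree. -/
theorem isTree {n : ℕ} (hn : 0 < n) : (graph n).IsTree := by
  refine ⟨connected hn, SimpleGraph.isAcyclic_iff_forall_adj_isBridge.2 ?_⟩
  have key : ∀ x : Tree n, (graph n).IsBridge s(x, parent x) := by
    intro x
    rw [SimpleGraph.isBridge_iff]
    rintro ⟨p⟩
    have inv : ∀ (y z : Tree n),
        ((graph n).deleteEdges {s(x, parent x)}).Walk y z →
        (∃ k : ℕ, parent^[k] y = x) → ∃ k : ℕ, parent^[k] z = x := by
      intro y z q
      induction q with
      | nil => exact id
      | @cons u v w h q ih =>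
        rintro ⟨k, hk⟩
        apply ih
        rw [SimpleGraph.deleteEdges_adj] at h
        obtain ⟨h | h, hne⟩ := h
        · cases k with
          | zero =>
            exfalso
            apply hne
            simp only [Function.iterate_zero, id_eq] at hk
            subst hk
            subst h
            rfl
          | succ k => exact ⟨k, by rw [← h]; exact hk⟩
        · exact ⟨k + 1, by rw [Function.iterate_succ_apply, h, hk]⟩
    obtain ⟨k, hk⟩ := inv _ _ p ⟨0, rfl⟩
    have := congrArg Tree.height hk
    rw [height_iterate, height_parent] at this
    omega
  intro x y h
  rcases h with rfl | rfl
  · exact key x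
  · rw [Sym2.eq_swap]
    exact key y

/-- `T_n` is regular of degree `n + 1`. -/
theorem ncard_neighborSet {n : ℕ} (x : Tree n) :
    ((graph n).neighborSet x).ncard = n + 1 := by
  have h : (graph n).neighborSet x = insert (parent x) (Set.range (child x)) := by
    ext y
    simp only [SimpleGraph.mem_neighborSet, Set.mem_insert_iff, Set.mem_range]
    constructor
    · rintro (h | h)
      · exact Or.inl h.symm
      · exact Or.inr (exists_child_eq x y h)
    · rintro (h | ⟨j, rfl⟩)
      · exact Or.inl h.symm
      · exact Or.inr (parent_child x j)
  rw [h, Set.ncard_insert_of_notMem _ (Set.finite_range _), ← Set.image_univ,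
    Set.ncard_image_of_injective _ (child_injective x), Set.ncard_univ, Nat.card_fin]
  rintro ⟨j, hj⟩
  have := congrArg Tree.height hj
  simp only [child, parent] at this
  omega

theorem dist_iterate {n : ℕ} (x : Tree n) (k : ℕ) :
    (graph n).dist x (parent^[k] x) = k := by
  obtain ⟨p, hp⟩ := exists_walk_iterate x k
  refine le_antisymm ((SimpleGraph.dist_le p).trans_eq hp) ?_
  obtain ⟨q, hq⟩ := p.reachable.exists_walk_length_eq_dist
  have := height_le_of_walk q
  rw [height_iterate, hq] at this
  omega

/-- Any two vertices have a confluent with respect to `-∞`. -/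
theorem exists_confluent {n : ℕ} (x y : Tree n) : ∃ c : Tree n, ray x ∩ ray y = ray c := by
  classical
  have hex : ∃ k : ℕ, parent^[k] x ∈ ray y := by
    obtain ⟨k, l, h⟩ := exists_iterate_eq x y
    exact ⟨k, l, h.symm⟩
  refine ⟨parent^[Nat.find hex] x, Set.ext fun z => ⟨?_, ?_⟩⟩
  · rintro ⟨⟨k, rfl⟩, hy⟩
    have hk : Nat.find hex ≤ k := Nat.find_min' hex hy
    refine ⟨k - Nat.find hex, ?_⟩
    change parent^[k - Nat.find hex] (parent^[Nat.find hex] x) = _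
    rw [← Function.iterate_add_apply, Nat.sub_add_cancel hk]
  · rintro ⟨k, rfl⟩
    obtain ⟨l, hl⟩ := Nat.find_spec hex
    refine ⟨⟨k + Nat.find hex, Function.iterate_add_apply _ _ _ _⟩, k + l, ?_⟩
    change parent^[k + l] y = parent^[k] (parent^[Nat.find hex] x)
    rw [← hl]
    exact Function.iterate_add_apply _ _ _ _

/-- The height is the Busemann function `b(x) = d(x, c) - d(o, c)`, where `c` is the confluent
of `x` and `o`. -/
theorem height_eq_busemann {n : ℕ} (hn : 0 < n) (x c : Tree n)
    (hc : ray x ∩ ray (origin n hn) = ray c) :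
    x.height = ((graph n).dist x c : ℤ) - (graph n).dist (origin n hn) c := by
  obtain ⟨⟨k, hk⟩, ⟨l, hl⟩⟩ : c ∈ ray x ∩ ray (origin n hn) := hc ▸ ⟨0, rfl⟩
  have h1 : (graph n).dist x c = k := by rw [← hk]; exact dist_iterate x k
  have h2 : (graph n).dist (origin n hn) c = l := by rw [← hl]; exact dist_iterate _ l
  have h3 : c.height = x.height - k := by rw [← hk]; exact height_iterate x k
  have h4 : c.height = 0 - l := by rw [← hl]; exact height_iterate _ l
  omega

end Tree

/-- The vertices of the Diestel-Leader graph `DL(m, n)`: pairs `(x, y)` in `T_m × T_n` with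
`b(x) + b'(y) = 0`. -/
def DL (m n : ℕ) : Type := {p : Tree m × Tree n // p.1.height + p.2.height = 0}

/-- The Diestel-Leader graph: `(x, y)` and `(x', y')` are adjacent if and only if `x, x'` are
adjacent in `T_m` and `y, y'` are adjacent in `T_n`. -/
def DL.graph (m n : ℕ) : SimpleGraph (DL m n) where
  Adj p q := (Tree.graph m).Adj p.1.1 q.1.1 ∧ (Tree.graph n).Adj p.1.2 q.1.2
  symm := ⟨fun _ _ h => ⟨h.1.symm, h.2.symm⟩⟩
  loopless := ⟨fun p h => (Tree.graph m).loopless.irrefl p.1.1 h.1⟩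

/-- The vertex set of a graph is a discrete space. -/
instance (m n : ℕ) : TopologicalSpace (DL m n) := ⊥

instance (m n : ℕ) : DiscreteTopology (DL m n) := ⟨rfl⟩

/-- The group `Γ` acts on `DL(m, n)` by graph automorphisms (equivalently, by isometries). -/
def ActsByAutomorphisms (Γ : Type*) [Group Γ] (m n : ℕ) [MulAction Γ (DL m n)] : Prop :=
  ∀ (g : Γ) (p q : DL m n), (DL.graph m n).Adj (g • p) (g • q) ↔ (DL.graph m n).Adj p q

/-- The action of `Γ` on `DL(m, n)` is cocompact: the orbit space is compact. -/
def ActsCocompactly (Γ : Type*) [Group Γ] (m n : ℕ) [MulAction Γ (DL m n)] : Prop :=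
  CompactSpace (Quotient (MulAction.orbitRel Γ (DL m n)))

end DiestelLeader

/-! An automorphism of DL(m, n) either preserves or reverses the direction of all edges, so it is
induced by a pair of end-preserving maps between the trees, possibly exchanging the two factors
(`exists_preserves_or_reverses`). This pair is unique, so Γ acts on the whole product T_m × T_n
(`exists_isLift`), which contains DL(m, n) as the level where the heights add up to 0.

The height shifts of the elements that do not exchange the trees form a subgroup dℤ, and d ≠ 0 by
cocompactness; the shifts of those that do lie in one class e₀ + dℤ. Take J ≡ e₀ modulo d, and let X
be the set of pairs whose heights add up to -J and whose first height is divisible by d. Then Γ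
preserves X. Joining two points of X when they are d steps apart turns X into DL(m^d, n^d), since a
vertex of T_m has m^d descendants d levels up (`coarsen`).

For large J the action on X is transitive (`IsLift.exists_transitive`): a point of X can be shifted
to lie deep in both trees, where it is a pair of far ancestors of a vertex of DL(m, n). There are
only finitely many orbits of such vertices, and far enough towards the ends the ancestors of their
representatives coincide. Properness survives because a transporter in X is open and is covered by
finitely many transporters in DL(m, n). -/

namespace DiestelLeader

open Function

/-! ### Ancestors, descendants and heights in a tree -/

namespace Tree

theorem exists_parent_eq {n : ℕ} (hn : 0 < n) (x : Tree n) : ∃ y, parent y = x :=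
  ⟨child x ⟨0, hn⟩, parent_child x _⟩

theorem exists_parent_eq_ne {n : ℕ} (hn : 2 ≤ n) (x z : Tree n) : ∃ y, parent y = x ∧ y ≠ z := by
  by_cases h : child x ⟨0, by omega⟩ = z
  · refine ⟨child x ⟨1, by omega⟩, parent_child x _, fun h' => ?_⟩
    simpa using child_injective x (h.trans h'.symm)
  · exact ⟨_, parent_child x _, h⟩

theorem exists_iterate_parent_eq {n : ℕ} (hn : 0 < n) (k : ℕ) (x : Tree n) :
    ∃ y, parent^[k] y = x := by
  induction k generalizing x with
  | zero => exact ⟨x, rfl⟩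
  | succ k ih =>
    obtain ⟨y, hy⟩ := exists_parent_eq hn x
    obtain ⟨z, hz⟩ := ih y
    exact ⟨z, by rw [iterate_succ_apply', hz, hy]⟩

theorem exists_height_eq {n : ℕ} (hn : 0 < n) (k : ℤ) : ∃ x : Tree n, x.height = k :=
  ⟨⟨k, fun _ => 0, fun _ _ => hn, fun _ _ => rfl, 0, fun _ _ => rfl⟩, rfl⟩

theorem exists_iterate_eq_of_height_eq {n : ℕ} {x y : Tree n} (h : x.height = y.height) :
    ∃ k, parent^[k] x = parent^[k] y := by
  obtain ⟨k, l, hkl⟩ := exists_iterate_eq x y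
  have h1 := congrArg Tree.height hkl
  rw [height_iterate, height_iterate] at h1
  obtain rfl : k = l := by omega
  exact ⟨k, hkl⟩

theorem finite_iterate_parent_fiber {n : ℕ} (k : ℕ) (x : Tree n) :
    {y | parent^[k] y = x}.Finite := by
  induction k generalizing x with
  | zero => exact (Set.finite_singleton x).subset fun y hy => hy
  | succ k ih =>
    refine (Set.finite_iUnion fun j : Fin n => ih (child x j)).subset fun y hy => ?_
    obtain ⟨j, hj⟩ := exists_child_eq x _ ((iterate_succ_apply' parent k y).symm.trans hy)
    exact Set.mem_iUnion.2 ⟨j, hj.symm⟩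

/-- Two vertices have a common ancestor, and both shifts agree with the shift there. -/
theorem height_sub_eq_of_semiconj {m n : ℕ} {f : Tree m → Tree n} (hf : Semiconj f parent parent)
    (x y : Tree m) : (f x).height - x.height = (f y).height - y.height := by
  obtain ⟨k, l, h⟩ := exists_iterate_eq x y
  have h1 := congrArg Tree.height h
  have h2 := congrArg (fun z => (f z).height) h
  simp only [(hf.iterate_right k).eq, (hf.iterate_right l).eq, height_iterate] at h1 h2
  omega

theorem digit_lt_of_pos {n : ℕ} (hn : 0 < n) (x : Tree n) (i : ℤ) : x.digit i < n := by
  by_cases h : i < x.height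
  · exact x.digit_lt i h
  · rwa [x.digit_eq_zero i (by omega)]

/-! ### T_{m^d} as every d-th level of T_m -/

/-- Write each digit of a vertex of `T_{m^d}` in base `m`. This identifies the tree `T_{m^d}` with
the vertices of `T_m` whose height is `-r` modulo `d`. -/
def expand {m d : ℕ} (hm : 0 < m) (hd : 0 < d) (r : ℤ) (u : Tree (m ^ d)) : Tree m where
  height := d * u.height - r
  digit i := u.digit ((i + r) / d) / m ^ ((i + r) % d).toNat % m
  digit_lt _ _ := Nat.mod_lt _ hm
  digit_eq_zero i hi := by
    rw [u.digit_eq_zero _ ((Int.le_ediv_iff_mul_le (by omega)).2 (by linarith))]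
    simp
  exists_forall_lt := by
    obtain ⟨N, hN⟩ := u.exists_forall_lt
    refine ⟨d * N - r, fun i hi => ?_⟩
    rw [hN _ ((Int.ediv_lt_iff_lt_mul (by omega)).2 (by linarith))]
    simp

section expand

variable {m d : ℕ} (hm : 0 < m) (hd : 0 < d) (r : ℤ)

theorem height_expand (u : Tree (m ^ d)) : (expand hm hd r u).height = d * u.height - r := rfl

/-- The digit of `u` at q fills the block of positions from dq - r to d(q + 1) - r - 1, so
forgetting one digit of `u` means forgetting one block. -/
theorem iterate_parent_expand (u : Tree (m ^ d)) :
    parent^[d] (expand hm hd r u) = expand hm hd r (parent u) := by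
  refine Tree.ext ?_ (funext fun i => ?_)
  · rw [height_iterate, height_expand, height_expand, height_parent]
    ring
  · rw [digit_iterate, height_expand]
    have h : i < d * u.height - r - d ↔ (i + r) / d < u.height - 1 := by
      rw [Int.ediv_lt_iff_lt_mul (by omega)]
      constructor <;> intro <;> linarith
    by_cases hi : (i + r) / d < u.height - 1
    · rw [if_pos (h.2 hi)]
      simp only [expand, parent]
      rw [if_pos hi]
    · rw [if_neg (mt h.1 hi)]
      simp only [expand, parent]
      rw [if_neg hi]
      simp

theorem expand_injective : Injective (expand hm hd r) := by
  intro u v h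
  have hpos : 0 < m ^ d := Nat.pow_pos hm
  refine Tree.ext ?_ (funext fun q => ?_)
  · have h1 := congrArg Tree.height h
    rw [height_expand, height_expand] at h1
    have h2 : (d : ℤ) * u.height = d * v.height := by linarith
    exact mul_left_cancel₀ (by omega) h2
  · have h1 : (⟨u.digit q, u.digit_lt_of_pos hpos q⟩ : Fin (m ^ d)) =
        ⟨v.digit q, v.digit_lt_of_pos hpos q⟩ := by
      apply finFunctionFinEquiv.symm.injective
      funext b
      apply Fin.ext
      rw [finFunctionFinEquiv_symm_apply_val, finFunctionFinEquiv_symm_apply_val]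
      -- This position holds the base-m digit number b of the digit at q.
      have h2 := congrFun (congrArg Tree.digit h) (b + d * q - r)
      have h3 : ((b : ℤ) + d * q) / d = q := by
        rw [Int.add_mul_ediv_left _ _ (by omega), Int.ediv_eq_zero_of_lt (by omega) (by omega)]
        simp
      have h4 : ((b : ℤ) + d * q) % d = b := by
        rw [Int.add_mul_emod_self_left, Int.emod_eq_of_lt (by omega) (by omega)]
      simpa only [expand, sub_add_cancel, h3, h4, Int.toNat_natCast] using h2
    exact congrArg Fin.val h1

theorem exists_expand_eq (x : Tree m) (hx : (d : ℤ) ∣ x.height + r) :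
    ∃ u, expand hm hd r u = x := by
  obtain ⟨k, hk⟩ := hx
  -- `f q` is the block of d digits of `x` that is packed into one digit below m^d. Blocks at or
  -- above the height are zero because the height of `x` is a block boundary.
  let f : ℤ → Fin d → Fin m := fun q s => ⟨x.digit (d * q + s - r), x.digit_lt_of_pos hm _⟩
  have hf : ∀ q, (∀ s : Fin d, x.digit (d * q + s - r) = 0) →
      (finFunctionFinEquiv (f q) : ℕ) = 0 := by
    intro q hq
    rw [finFunctionFinEquiv_apply]
    exact Finset.sum_eq_zero fun s _ => by simp only [f, hq, zero_mul]
  refine ⟨⟨k, fun q => finFunctionFinEquiv (f q), fun q _ => Fin.is_lt _, fun q hq => ?_, ?_⟩, ?_⟩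
  · refine hf q fun s => x.digit_eq_zero _ ?_
    have : (d : ℤ) * k ≤ d * q := by gcongr
    omega
  · obtain ⟨N, hN⟩ := x.exists_forall_lt
    refine ⟨(N + r) / d, fun q hq => hf q fun s => hN _ ?_⟩
    have h1 : (d : ℤ) * (q + 1) ≤ d * ((N + r) / d) := by gcongr; omega
    have h2 := Int.mul_ediv_self_le (x := N + r) (k := d) (by omega)
    have := s.2
    linarith
  · refine Tree.ext ?_ (funext fun i => ?_)
    · rw [height_expand]
      simp only
      omega
    · have h1 : 0 ≤ (i + r) % d := Int.emod_nonneg _ (by omega)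
      have h2 : (i + r) % d < d := Int.emod_lt_of_pos _ (by omega)
      have h3 := finFunctionFinEquiv_symm_apply_val (finFunctionFinEquiv (f ((i + r) / d)))
        ⟨((i + r) % d).toNat, by omega⟩
      rw [Equiv.symm_apply_apply] at h3
      simp only [expand]
      rw [← h3]
      simp only [f]
      congr 1
      rw [Int.toNat_of_nonneg h1, Int.mul_ediv_add_emod]
      ring

end expand

end Tree

/-! ### Proper actions on discrete spaces -/

/-- A group acts properly on a discrete space if and only if the transporters between points are
open and compact. -/
theorem properSMul_iff_of_discreteTopology {G X : Type*} [Group G] [TopologicalSpace G]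
    [TopologicalSpace X] [DiscreteTopology X] [MulAction G X] :
    ProperSMul G X ↔
      ∀ x y : X, IsOpen {g : G | g • x = y} ∧ IsCompact {g : G | g • x = y} := by
  have key : ∀ x y : X, (fun gx : G × X => (gx.1 • gx.2, gx.2)) ⁻¹' {(y, x)} =
      (fun g => (g, x)) '' {g : G | g • x = y} := by
    intro x y
    ext ⟨g, z⟩
    simp only [Set.mem_preimage, Set.mem_singleton_iff, Prod.mk.injEq, Set.mem_image,
      Set.mem_ofPred_eq]
    constructor
    · rintro ⟨h, rfl⟩
      exact ⟨g, h, rfl, rfl⟩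
    · rintro ⟨g, h, rfl, rfl⟩
      exact ⟨h, rfl⟩
  constructor
  · intro h x y
    constructor
    · exact (isOpen_discrete {y}).preimage (continuous_id.smul continuous_const)
    · have h1 := (h.isProperMap_smul_pair.isCompact_preimage
        (isCompact_singleton (x := (y, x)))).image continuous_fst
      rwa [key, Set.image_image, Set.image_id'] at h1
  · refine fun h => ⟨isProperMap_iff_isCompact_preimage.2 ⟨?_, fun K hK => ?_⟩⟩
    · refine Continuous.prodMk (continuous_discrete_rng.2 fun y => ?_) continuous_snd
      have : (fun gx : G × X => gx.1 • gx.2) ⁻¹' {y} = ⋃ x, {g : G | g • x = y} ×ˢ {x} := by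
        ext ⟨g, z⟩
        simp
      rw [this]
      exact isOpen_iUnion fun x => (h x y).1.prod (isOpen_discrete _)
    · rw [← Set.biUnion_of_singleton K, Set.preimage_iUnion₂]
      refine hK.finite_of_discrete.isCompact_biUnion fun yx _ => ?_
      rw [key yx.2 yx.1]
      exact (h _ _).2.image (by fun_prop)

/-! ### Upward edges and connectedness of the Diestel-Leader graph -/

namespace DL

/-- `q` is obtained from `p` by a step away from the end of `T_m` and towards the end of `T_n`. -/
def Up {m n : ℕ} (p q : DL m n) : Prop :=
  Tree.parent q.1.1 = p.1.1 ∧ Tree.parent p.1.2 = q.1.2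

theorem Up.adj {m n : ℕ} {p q : DL m n} (h : Up p q) : (graph m n).Adj p q :=
  ⟨Or.inr h.1, Or.inl h.2⟩

theorem Up.height_eq {m n : ℕ} {p q : DL m n} (h : Up p q) :
    q.1.1.height = p.1.1.height + 1 := by
  rw [← h.1, Tree.height_parent]
  ring

/-- Moving both coordinates in the same direction would change the sum of the heights by 2. -/
theorem adj_iff {m n : ℕ} {p q : DL m n} : (graph m n).Adj p q ↔ Up p q ∨ Up q p := by
  refine ⟨?_, fun h => h.elim Up.adj fun h => h.adj.symm⟩
  have hp := p.2
  have hq := q.2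
  rintro ⟨h1 | h1, h2 | h2⟩
  · have e1 := congrArg Tree.height h1
    have e2 := congrArg Tree.height h2
    simp only [Tree.height_parent] at e1 e2
    omega
  · exact Or.inr ⟨h1, h2⟩
  · exact Or.inl ⟨h1, h2⟩
  · have e1 := congrArg Tree.height h1
    have e2 := congrArg Tree.height h2
    simp only [Tree.height_parent] at e1 e2
    omega

/-- Exchange the two trees. -/
def flip (m n : ℕ) : DL m n ≃ DL n m where
  toFun p := ⟨p.1.swap, by have := p.2; simp only [Prod.fst_swap, Prod.snd_swap]; omega⟩
  invFun p := ⟨p.1.swap, by have := p.2; simp only [Prod.fst_swap, Prod.snd_swap]; omega⟩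
  left_inv _ := rfl
  right_inv _ := rfl

theorem up_flip_iff {m n : ℕ} {p q : DL m n} : Up (flip m n p) (flip m n q) ↔ Up q p :=
  and_comm

theorem flip_adj_iff {m n : ℕ} {p q : DL m n} :
    (graph n m).Adj (flip m n p) (flip m n q) ↔ (graph m n).Adj p q :=
  and_comm

theorem exists_up_fst {m n : ℕ} (p : DL m n) (x : Tree m) (hx : Tree.parent x = p.1.1) :
    ∃ q, Up p q ∧ q.1.1 = x := by
  refine ⟨⟨(x, Tree.parent p.1.2), ?_⟩, ⟨hx, rfl⟩, rfl⟩
  have h1 := p.2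
  have h2 := congrArg Tree.height hx
  simp only [Tree.height_parent] at h2 ⊢
  omega

theorem exists_up_snd {m n : ℕ} (p : DL m n) (y : Tree n) (hy : Tree.parent y = p.1.2) :
    ∃ q, Up q p ∧ q.1.2 = y := by
  obtain ⟨q, hq, h⟩ := exists_up_fst (flip m n p) y hy
  exact ⟨flip n m q, up_flip_iff.1 hq, h⟩

theorem exists_up_pair {m n : ℕ} (hm : 0 < m) {p q : DL m n} (h : p.1.1 = q.1.1) :
    ∃ p' q', Up p p' ∧ Up q q' ∧ p'.1.1 = q'.1.1 := by
  obtain ⟨x, hx⟩ : ∃ x, Tree.parent x = p.1.1 := Tree.exists_parent_eq hm _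
  obtain ⟨p', hp, hp'⟩ := exists_up_fst p x hx
  obtain ⟨q', hq, hq'⟩ := exists_up_fst q x (hx.trans h)
  exact ⟨p', q', hp, hq, hp'.trans hq'.symm⟩

/-- Induction principle for pairs of vertices with the same first coordinate. -/
theorem fst_eq_induction {m n : ℕ} (hm : 0 < m) {R : DL m n → DL m n → Prop}
    (refl : ∀ p, R p p)
    (step : ∀ p q p' q', Up p p' → Up q q' → R p' q' → R p q)
    (p q : DL m n) (h : p.1.1 = q.1.1) : R p q := by
  have hp := p.2
  have hq := q.2
  obtain ⟨k, l, hk⟩ := Tree.exists_iterate_eq p.1.2 q.1.2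
  have h1 := congrArg Tree.height hk
  rw [Tree.height_iterate, Tree.height_iterate] at h1
  rw [h] at hp
  obtain rfl : k = l := by omega
  clear hp hq h1
  -- Each common upward step replaces the second coordinates by their parents and so uses up one of
  -- the k steps until they merge.
  induction k generalizing p q with
  | zero =>
    obtain rfl : p = q := Subtype.ext (Prod.ext h hk)
    exact refl p
  | succ k ih =>
    obtain ⟨p', q', hp, hq, h'⟩ := exists_up_pair hm h
    refine step p q p' q' hp hq (ih p' q' h' ?_)
    rwa [iterate_succ_apply, iterate_succ_apply, hp.2, hq.2] at hk

theorem reachable_of_fst_eq {m n : ℕ} (hm : 0 < m) (p q : DL m n) (h : p.1.1 = q.1.1) :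
    (graph m n).Reachable p q :=
  fst_eq_induction hm (R := (graph m n).Reachable) .refl
    (fun _ _ _ _ hp hq h => hp.adj.reachable.trans (h.trans hq.adj.reachable.symm)) p q h

theorem reachable_of_snd_eq {m n : ℕ} (hn : 0 < n) (p q : DL m n) (h : p.1.2 = q.1.2) :
    (graph m n).Reachable p q :=
  (reachable_of_fst_eq hn (flip m n p) (flip m n q) h).map
    (⟨flip n m, flip_adj_iff.2⟩ : graph n m →g graph m n)

theorem preconnected {m n : ℕ} (hm : 0 < m) (hn : 0 < n) : (graph m n).Preconnected := by
  have key : ∀ (k : ℤ) (p : DL m n),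
      ∃ q, (graph m n).Reachable p q ∧ q.1.1.height = p.1.1.height + k := by
    intro k
    induction k using Int.induction_on with
    | zero => exact fun p => ⟨p, .refl p, by simp⟩
    | succ k ih =>
      intro p
      obtain ⟨q, hq, h⟩ := ih p
      obtain ⟨q', hq', -⟩ := exists_up_fst q _ (Tree.parent_child _ ⟨0, hm⟩)
      exact ⟨q', hq.trans hq'.adj.reachable, by rw [hq'.height_eq, h]; ring⟩
    | pred k ih =>
      intro p
      obtain ⟨q, hq, h⟩ := ih p
      obtain ⟨q', hq', -⟩ := exists_up_snd q _ (Tree.parent_child _ ⟨0, hn⟩)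
      exact ⟨q', hq.trans hq'.adj.reachable.symm, by have := hq'.height_eq; omega⟩
  intro p q
  obtain ⟨p', hp', h⟩ := key (q.1.1.height - p.1.1.height) p
  have hq := q.2
  -- Once the heights agree, the coordinates can be changed one at a time.
  have h1 := reachable_of_fst_eq hm p' ⟨(p'.1.1, q.1.2), by simp only; omega⟩ rfl
  exact hp'.trans (h1.trans (reachable_of_snd_eq hn _ q rfl))

/-- Both upper neighbours have the parent of `p.1.2` as second coordinate, so `p.1.2` can be
replaced by a sibling. -/
theorem exists_ne_common_up {m n : ℕ} (hn : 2 ≤ n) {p q q' : DL m n} (h : Up p q) (h' : Up p q') :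
    ∃ r, r ≠ p ∧ Up r q ∧ Up r q' := by
  obtain ⟨y, hy, hne⟩ : ∃ y, Tree.parent y = q.1.2 ∧ y ≠ p.1.2 :=
    Tree.exists_parent_eq_ne hn _ _
  obtain ⟨r, hr, rfl⟩ := exists_up_snd q y hy
  refine ⟨r, fun h => hne (by rw [h]), hr, ?_, ?_⟩
  · rw [h'.1, ← h.1, hr.1]
  · rw [hr.2, ← h.2, h'.2]

theorem exists_ne_common_up' {m n : ℕ} (hm : 2 ≤ m) {p q q' : DL m n} (h : Up q p)
    (h' : Up q' p) : ∃ r, r ≠ p ∧ Up q r ∧ Up q' r := by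
  obtain ⟨r, hr, h1, h2⟩ := exists_ne_common_up hm (up_flip_iff.2 h) (up_flip_iff.2 h')
  refine ⟨flip n m r, fun h => hr ?_, up_flip_iff.1 h1, up_flip_iff.1 h2⟩
  rw [← h]
  rfl

/-- The heights of `q` and `q'` differ by 2, so `r` lies between them: its first coordinate is the
parent of that of `q'`, and its second the parent of that of `q`. -/
theorem eq_of_adj_of_up {m n : ℕ} {p q q' r : DL m n} (h : Up q p) (h' : Up p q')
    (hr : (graph m n).Adj r q) (hr' : (graph m n).Adj r q') : r = p := by
  have e := h.height_eq
  have e' := h'.height_eq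
  rw [adj_iff] at hr hr'
  rcases hr with hr | hr <;> rcases hr' with hr' | hr' <;>
    have f := hr.height_eq <;> have f' := hr'.height_eq
  · omega
  · omega
  · exact Subtype.ext (Prod.ext (hr'.1.symm.trans h'.1) (hr.2.symm.trans h.2))
  · omega

/-! ### Isomorphisms preserve or reverse all directions -/

variable {m n m' n' : ℕ}

/-- The edges at a vertex are divided into upward and downward edges, and two edges at a vertex
have the same direction if and only if their other ends have another common neighbour. Hence an
isomorphism that preserves the direction of one edge preserves the direction of its neighbours. -/
theorem up_map_of_up_of_up (hn : 2 ≤ n) {φ : DL m n ≃ DL m' n'}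
    (hφ : ∀ p q, (graph m' n').Adj (φ p) (φ q) ↔ (graph m n).Adj p q) {p q q' : DL m n}
    (hq : Up p q) (hφq : Up (φ p) (φ q)) (hq' : Up p q') : Up (φ p) (φ q') := by
  refine (adj_iff.1 ((hφ p q').2 hq'.adj)).resolve_right fun h => ?_
  obtain ⟨r, hr, h1, h2⟩ := exists_ne_common_up hn hq hq'
  exact hr (φ.injective (eq_of_adj_of_up h hφq ((hφ r q').2 h2.adj) ((hφ r q).2 h1.adj)))

/-- The argument is run in the target: if both images were above `φ p`, they would have a second
common neighbour, whereas `p` is the only common neighbour of `q` and `q'`. -/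
theorem up_map_of_up_of_down (hn' : 2 ≤ n') {φ : DL m n ≃ DL m' n'}
    (hφ : ∀ p q, (graph m' n').Adj (φ p) (φ q) ↔ (graph m n).Adj p q) {p q q' : DL m n}
    (hq : Up p q) (hφq : Up (φ p) (φ q)) (hq' : Up q' p) : Up (φ q') (φ p) := by
  refine (adj_iff.1 ((hφ q' p).2 hq'.adj)).resolve_right fun h => ?_
  obtain ⟨r, hr, h1, h2⟩ := exists_ne_common_up hn' hφq h
  obtain ⟨s, rfl⟩ := φ.surjective r
  exact hr (congrArg φ (eq_of_adj_of_up hq' hq ((hφ _ _).1 h2.adj) ((hφ _ _).1 h1.adj)))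

theorem up_map_of_down_of_up (hm' : 2 ≤ m') {φ : DL m n ≃ DL m' n'}
    (hφ : ∀ p q, (graph m' n').Adj (φ p) (φ q) ↔ (graph m n).Adj p q) {p q q' : DL m n}
    (hq : Up q p) (hφq : Up (φ q) (φ p)) (hq' : Up p q') : Up (φ p) (φ q') := by
  refine (adj_iff.1 ((hφ p q').2 hq'.adj)).resolve_right fun h => ?_
  obtain ⟨r, hr, h1, h2⟩ := exists_ne_common_up' hm' hφq h
  obtain ⟨s, rfl⟩ := φ.surjective r
  exact hr (congrArg φ (eq_of_adj_of_up hq hq' ((hφ _ _).1 h1.adj.symm)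
    ((hφ _ _).1 h2.adj.symm)))

theorem up_map_of_exists (hm : 2 ≤ m) (hn : 2 ≤ n) (hm' : 2 ≤ m') (hn' : 2 ≤ n')
    {φ : DL m n ≃ DL m' n'} (hφ : ∀ p q, (graph m' n').Adj (φ p) (φ q) ↔ (graph m n).Adj p q)
    {p₀ q₀ : DL m n} (h₀ : Up p₀ q₀) (h₀' : Up (φ p₀) (φ q₀)) (p q : DL m n) (h : Up p q) :
    Up (φ p) (φ q) := by
  suffices H : ∀ p, (graph m n).Reachable p₀ p → ∀ q, Up p q → Up (φ p) (φ q) from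
    H p (preconnected (by omega) (by omega) p₀ p) q h
  intro p hp
  rw [SimpleGraph.reachable_iff_reflTransGen] at hp
  induction hp with
  | refl => exact fun q => up_map_of_up_of_up hn hφ h₀ h₀'
  | @tail r s _ hrs ih =>
    rcases adj_iff.1 hrs with h1 | h1
    · exact fun q => up_map_of_down_of_up hm' hφ h1 (ih s h1)
    -- The induction hypothesis speaks only of the edges going up from `r`. Such an edge, to `t`,
    -- fixes the direction of the edge from `s` up to `r`, and that one settles the others going up
    -- from `s`.
    · obtain ⟨x, hx⟩ := Tree.exists_parent_eq (by omega) r.1.1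
      obtain ⟨t, ht, -⟩ := exists_up_fst r x hx
      exact fun q => up_map_of_up_of_up hn hφ h1 (up_map_of_up_of_down hn' hφ ht (ih t ht) h1)

theorem up_map_or_down_map (hm : 2 ≤ m) (hn : 2 ≤ n) (hm' : 2 ≤ m') (hn' : 2 ≤ n')
    {φ : DL m n ≃ DL m' n'} (hφ : ∀ p q, (graph m' n').Adj (φ p) (φ q) ↔ (graph m n).Adj p q) :
    (∀ p q, Up p q → Up (φ p) (φ q)) ∨ ∀ p q, Up p q → Up (φ q) (φ p) := by
  by_cases h : ∃ p q, Up p q ∧ Up (φ p) (φ q)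
  · obtain ⟨p, q, h, h'⟩ := h
    exact Or.inl (up_map_of_exists hm hn hm' hn' hφ h h')
  · refine Or.inr fun p q hpq => ?_
    exact (adj_iff.1 ((hφ p q).2 hpq.adj)).resolve_left fun h' => h ⟨p, q, hpq, h'⟩

/-! ### Direction-preserving maps split into maps of the trees -/

/-- Climbing along equal first coordinates leads to a common vertex, and on the way back the first
coordinates of the images are obtained by taking parents. -/
theorem fst_map_eq (hm : 0 < m) {φ : DL m n → DL m' n'} (hφ : ∀ p q, Up p q → Up (φ p) (φ q))
    (p q : DL m n) (h : p.1.1 = q.1.1) : (φ p).1.1 = (φ q).1.1 :=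
  fst_eq_induction hm (R := fun p q => (φ p).1.1 = (φ q).1.1) (fun _ => rfl)
    (fun p q p' q' hp hq h => by rw [← (hφ _ _ hp).1, ← (hφ _ _ hq).1, h]) p q h

theorem exists_fst_eq (hn : 0 < n) (x : Tree m) : ∃ p : DL m n, p.1.1 = x := by
  obtain ⟨y, hy⟩ := Tree.exists_height_eq hn (-x.height)
  exact ⟨⟨(x, y), by simp only; omega⟩, rfl⟩

theorem exists_snd_eq (hm : 0 < m) (y : Tree n) : ∃ p : DL m n, p.1.2 = y := by
  obtain ⟨p, hp⟩ := exists_fst_eq hm y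
  exact ⟨flip n m p, hp⟩

theorem exists_fst_map (hm : 0 < m) (hn : 0 < n) {φ : DL m n → DL m' n'}
    (hφ : ∀ p q, Up p q → Up (φ p) (φ q)) :
    ∃ α : Tree m → Tree m', Semiconj α Tree.parent Tree.parent ∧ ∀ p, (φ p).1.1 = α p.1.1 := by
  choose s hs using fun x : Tree m => exists_fst_eq hn x
  have key : ∀ p, (φ p).1.1 = (φ (s p.1.1)).1.1 := fun p => fst_map_eq hm hφ _ _ (hs _).symm
  refine ⟨fun x => (φ (s x)).1.1, fun x => ?_, key⟩
  obtain ⟨y, hy⟩ := Tree.exists_parent_eq hn (s x).1.2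
  obtain ⟨q, hq, -⟩ := exists_up_snd (s x) y hy
  rw [(hφ _ _ hq).1, key q, ← hq.1, hs]

theorem exists_snd_map (hm : 0 < m) (hn : 0 < n) {φ : DL m n → DL m' n'}
    (hφ : ∀ p q, Up p q → Up (φ p) (φ q)) :
    ∃ β : Tree n → Tree n', Semiconj β Tree.parent Tree.parent ∧ ∀ p, (φ p).1.2 = β p.1.2 := by
  obtain ⟨β, hβ, h⟩ := exists_fst_map (φ := fun p => flip m' n' (φ (flip n m p))) hn hm
    fun p q hpq => up_flip_iff.2 (hφ _ _ (up_flip_iff.2 hpq))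
  exact ⟨β, hβ, fun p => h (flip m n p)⟩

end DL

/-! ### Maps of T_m × T_n that preserve or exchange the factors -/

/-- `f` is the product of two maps between trees that preserve the ends, the first of which adds `e`
to the heights while the second one subtracts `e`. -/
def Preserves {m n m' n' : ℕ} (f : Tree m × Tree n → Tree m' × Tree n') (e : ℤ) : Prop :=
  ∃ (α : Tree m → Tree m') (β : Tree n → Tree n'),
    Semiconj α Tree.parent Tree.parent ∧ Semiconj β Tree.parent Tree.parent ∧
    (∀ x, (α x).height = x.height + e) ∧ (∀ y, (β y).height = y.height - e) ∧ f = Prod.map α β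

/-- `f` exchanges the two trees, and preserves the ends. -/
def Reverses {m n m' n' : ℕ} (f : Tree m × Tree n → Tree m' × Tree n') (e : ℤ) : Prop :=
  Preserves (f ∘ Prod.swap) e

section

variable {m n m' n' m'' n'' : ℕ} {f : Tree m' × Tree n' → Tree m'' × Tree n''}
  {f' : Tree m × Tree n → Tree m' × Tree n'} {e e' : ℤ}

theorem Preserves.id : Preserves (id : Tree m × Tree n → Tree m × Tree n) 0 :=
  ⟨_root_.id, _root_.id, fun _ => rfl, fun _ => rfl, fun _ => (add_zero _).symm,
    fun _ => (sub_zero _).symm, rfl⟩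

theorem Preserves.comp (h : Preserves f e) (h' : Preserves f' e') :
    Preserves (f ∘ f') (e + e') := by
  obtain ⟨α, β, hα, hβ, eα, eβ, rfl⟩ := h
  obtain ⟨α', β', hα', hβ', eα', eβ', rfl⟩ := h'
  refine ⟨α ∘ α', β ∘ β', hα.comp_left hα', hβ.comp_left hβ', fun x => ?_, fun y => ?_, rfl⟩
  · rw [comp_apply, eα, eα']
    ring
  · rw [comp_apply, eβ, eβ']
    ring

theorem Preserves.conj_swap (h : Preserves f e) :
    Preserves (Prod.swap ∘ f ∘ Prod.swap) (-e) := by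
  obtain ⟨α, β, hα, hβ, eα, eβ, rfl⟩ := h
  exact ⟨β, α, hβ, hα, fun x => (eβ x).trans (sub_eq_add_neg _ _),
    fun y => (eα y).trans (sub_neg_eq_add _ _).symm, rfl⟩

theorem Preserves.comp_reverses (h : Preserves f e) (h' : Reverses f' e') :
    Reverses (f ∘ f') (e + e') :=
  show Preserves (f ∘ f' ∘ Prod.swap) (e + e') from Preserves.comp h h'

theorem Reverses.comp_preserves (h : Reverses f e) (h' : Preserves f' e') :
    Reverses (f ∘ f') (e - e') := by
  have := Preserves.comp h h'.conj_swap
  rwa [← sub_eq_add_neg] at this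

theorem Reverses.comp (h : Reverses f e) (h' : Reverses f' e') :
    Preserves (f ∘ f') (e - e') := by
  have := Preserves.comp h (Preserves.conj_swap h')
  rwa [← sub_eq_add_neg] at this

end

section

variable {m n m' n' : ℕ} {f f' : Tree m × Tree n → Tree m' × Tree n'} {e e' : ℤ}

theorem Preserves.height_fst (h : Preserves f e) (z : Tree m × Tree n) :
    (f z).1.height = z.1.height + e := by
  obtain ⟨α, β, hα, hβ, eα, eβ, rfl⟩ := h
  exact eα _

theorem Preserves.height_snd (h : Preserves f e) (z : Tree m × Tree n) :
    (f z).2.height = z.2.height - e := by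
  obtain ⟨α, β, hα, hβ, eα, eβ, rfl⟩ := h
  exact eβ _

theorem Reverses.height_fst (h : Reverses f e) (z : Tree m × Tree n) :
    (f z).1.height = z.2.height + e :=
  Preserves.height_fst h z.swap

theorem Reverses.height_snd (h : Reverses f e) (z : Tree m × Tree n) :
    (f z).2.height = z.1.height - e :=
  Preserves.height_snd h z.swap

/-- On DL(m, n) the first height of the image would both increase and decrease with the first height
k. -/
theorem Preserves.not_reverses (hm : 0 < m) (hn : 0 < n) (h : Preserves f e)
    (h' : Reverses f' e') (heq : ∀ p : DL m n, f p.1 = f' p.1) : False := by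
  have key : ∀ k : ℤ, k + e = -k + e' := by
    intro k
    obtain ⟨x, hx⟩ := Tree.exists_height_eq hm k
    obtain ⟨⟨⟨x, y⟩, hxy⟩, rfl⟩ := DL.exists_fst_eq hn x
    have h1 := h.height_fst (x, y)
    have h2 := h'.height_fst (x, y)
    rw [heq ⟨(x, y), hxy⟩] at h1
    simp only at h1 h2 hx hxy
    omega
  have h0 := key 0
  have h1 := key 1
  omega

theorem Preserves.ext (hm : 0 < m) (hn : 0 < n) (h : Preserves f e) (h' : Preserves f' e')
    (heq : ∀ p : DL m n, f p.1 = f' p.1) : f = f' := by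
  obtain ⟨α, β, -, -, -, -, rfl⟩ := h
  obtain ⟨α', β', -, -, -, -, rfl⟩ := h'
  congr 1
  · funext x
    obtain ⟨p, rfl⟩ := DL.exists_fst_eq hn x
    exact congrArg Prod.fst (heq p)
  · funext y
    obtain ⟨p, rfl⟩ := DL.exists_snd_eq hm y
    exact congrArg Prod.snd (heq p)

theorem Reverses.ext (hm : 0 < m) (hn : 0 < n) (h : Reverses f e) (h' : Reverses f' e')
    (heq : ∀ p : DL m n, f p.1 = f' p.1) : f = f' := by
  have := Preserves.ext hn hm h h' fun p => heq (DL.flip n m p)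
  exact Prod.swap_surjective.injective_comp_right this

/-- Every vertex of either tree is a coordinate of a vertex of DL(m, n). This uniqueness makes the
extension of an action multiplicative. -/
theorem eq_of_eq_on_DL (hm : 0 < m) (hn : 0 < n) (h : ∃ e, Preserves f e ∨ Reverses f e)
    (h' : ∃ e, Preserves f' e ∨ Reverses f' e) (heq : ∀ p : DL m n, f p.1 = f' p.1) :
    f = f' := by
  obtain ⟨e, h | h⟩ := h <;> obtain ⟨e', h' | h'⟩ := h'
  · exact h.ext hm hn h' heq
  · exact (h.not_reverses hm hn h' heq).elim
  · exact (h'.not_reverses hm hn h fun p => (heq p).symm).elim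
  · exact h.ext hm hn h' heq

theorem exists_preserves_of_up_map (hm : 0 < m) (hn : 0 < n) {φ : DL m n → DL m' n'}
    (hφ : ∀ p q, DL.Up p q → DL.Up (φ p) (φ q)) :
    ∃ (f : Tree m × Tree n → Tree m' × Tree n') (e : ℤ),
      Preserves f e ∧ ∀ p, f p.1 = (φ p).1 := by
  obtain ⟨α, hα, eα⟩ := DL.exists_fst_map hm hn hφ
  obtain ⟨β, hβ, eβ⟩ := DL.exists_snd_map hm hn hφ
  obtain ⟨x₀, -⟩ := Tree.exists_height_eq hm 0
  have h1 : ∀ x, (α x).height = x.height + ((α x₀).height - x₀.height) := by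
    intro x
    have := Tree.height_sub_eq_of_semiconj hα x x₀
    omega
  refine ⟨Prod.map α β, _, ⟨α, β, hα, hβ, h1, fun y => ?_, rfl⟩,
    fun p => (Prod.ext (eα p) (eβ p)).symm⟩
  -- The two shifts are opposite because the heights add up to 0 at `p` and at `φ p`.
  obtain ⟨p, rfl⟩ := DL.exists_snd_eq hm y
  have h2 := h1 p.1.1
  have h3 := p.2
  have h4 := (φ p).2
  rw [eα, eβ] at h4
  omega

/-- Every automorphism of `DL(m, n)` is induced by maps between the trees. -/
theorem exists_preserves_or_reverses (hm : 2 ≤ m) (hn : 2 ≤ n) (φ : DL m n ≃ DL m n)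
    (hφ : ∀ p q, (DL.graph m n).Adj (φ p) (φ q) ↔ (DL.graph m n).Adj p q) :
    ∃ f : Tree m × Tree n → Tree m × Tree n,
      (∃ e, Preserves f e ∨ Reverses f e) ∧ ∀ p, f p.1 = (φ p).1 := by
  rcases DL.up_map_or_down_map hm hn hm hn hφ with h | h
  · obtain ⟨f, e, hf, h⟩ := exists_preserves_of_up_map (by omega) (by omega) h
    exact ⟨f, ⟨e, Or.inl hf⟩, h⟩
  · obtain ⟨f, e, hf, h⟩ := exists_preserves_of_up_map (φ := fun p => φ (DL.flip n m p))
      (by omega) (by omega) fun p q hpq => h _ _ (DL.up_flip_iff.2 hpq)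
    exact ⟨f ∘ Prod.swap, ⟨e, Or.inr hf⟩, fun p => h (DL.flip m n p)⟩

end

section

variable {m n m' n' : ℕ} {f : Tree m × Tree n → Tree m' × Tree n'} {e : ℤ}

theorem Preserves.fst_congr (h : Preserves f e) {z w : Tree m × Tree n} (hzw : z.1 = w.1) :
    (f z).1 = (f w).1 := by
  obtain ⟨α, β, -, -, -, -, rfl⟩ := h
  exact congrArg α hzw

theorem Preserves.snd_congr (h : Preserves f e) {z w : Tree m × Tree n} (hzw : z.2 = w.2) :
    (f z).2 = (f w).2 := by
  obtain ⟨α, β, -, -, -, -, rfl⟩ := h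
  exact congrArg β hzw

theorem Preserves.map_iterate_parent (h : Preserves f e) (k l : ℕ) (z : Tree m × Tree n) :
    f (Tree.parent^[k] z.1, Tree.parent^[l] z.2) =
      (Tree.parent^[k] (f z).1, Tree.parent^[l] (f z).2) := by
  obtain ⟨α, β, hα, hβ, -, -, rfl⟩ := h
  exact Prod.ext (hα.iterate_right k z.1) (hβ.iterate_right l z.2)

theorem Reverses.fst_congr (h : Reverses f e) {z w : Tree m × Tree n} (hzw : z.2 = w.2) :
    (f z).1 = (f w).1 :=
  Preserves.fst_congr h (z := z.swap) (w := w.swap) hzw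

theorem Reverses.snd_congr (h : Reverses f e) {z w : Tree m × Tree n} (hzw : z.1 = w.1) :
    (f z).2 = (f w).2 :=
  Preserves.snd_congr h (z := z.swap) (w := w.swap) hzw

theorem Reverses.map_iterate_parent (h : Reverses f e) (k l : ℕ) (z : Tree m × Tree n) :
    f (Tree.parent^[k] z.1, Tree.parent^[l] z.2) =
      (Tree.parent^[l] (f z).1, Tree.parent^[k] (f z).2) :=
  Preserves.map_iterate_parent h l k z.swap

end

section

variable {Γ : Type*} [Group Γ] {m n : ℕ} [MulAction Γ (Tree m × Tree n)]

theorem Preserves.smul_mul {g g' : Γ} {e e' : ℤ}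
    (hg : Preserves (fun z : Tree m × Tree n => g • z) e)
    (hg' : Preserves (fun z : Tree m × Tree n => g' • z) e') :
    Preserves (fun z : Tree m × Tree n => (g * g') • z) (e + e') := by
  simpa only [comp_def, ← mul_smul] using hg.comp hg'

theorem Reverses.smul_mul {g g' : Γ} {e e' : ℤ}
    (hg : Reverses (fun z : Tree m × Tree n => g • z) e)
    (hg' : Reverses (fun z : Tree m × Tree n => g' • z) e') :
    Preserves (fun z : Tree m × Tree n => (g * g') • z) (e - e') := by
  simpa only [comp_def, ← mul_smul] using hg.comp hg'

end

/-! ### The action on T_m × T_n and its height shifts -/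

/-- An action on `T_m × T_n` that extends an action on `DL(m, n)` by automorphisms. -/
structure IsLift (Γ : Type*) [Group Γ] (m n : ℕ) [MulAction Γ (DL m n)]
    [MulAction Γ (Tree m × Tree n)] : Prop where
  smul_coe : ∀ (g : Γ) (p : DL m n), g • p.1 = (g • p).1
  preserves_or_reverses : ∀ g : Γ, ∃ e,
    Preserves (fun z : Tree m × Tree n => g • z) e ∨ Reverses (fun z : Tree m × Tree n => g • z) e

theorem exists_isLift {Γ : Type*} [Group Γ] {m n : ℕ} [MulAction Γ (DL m n)] (hm : 2 ≤ m)
    (hn : 2 ≤ n) (hauto : ActsByAutomorphisms Γ m n) :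
    ∃ _ : MulAction Γ (Tree m × Tree n), IsLift Γ m n := by
  choose F hF hFp using fun g : Γ =>
    exists_preserves_or_reverses hm hn (MulAction.toPerm g : Equiv.Perm (DL m n)) (hauto g)
  have h1 : F 1 = id := eq_of_eq_on_DL (by omega) (by omega) (hF 1) ⟨0, Or.inl .id⟩ fun p => by
    rw [hFp, MulAction.toPerm_apply, one_smul]
    rfl
  have hmul : ∀ g h, F (g * h) = F g ∘ F h := by
    refine fun g h => eq_of_eq_on_DL (by omega) (by omega) (hF _) ?_ fun p => ?_
    · obtain ⟨e, he | he⟩ := hF g <;> obtain ⟨e', he' | he'⟩ := hF h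
      · exact ⟨_, Or.inl (he.comp he')⟩
      · exact ⟨_, Or.inr (he.comp_reverses he')⟩
      · exact ⟨_, Or.inr (he.comp_preserves he')⟩
      · exact ⟨_, Or.inl (he.comp he')⟩
    · rw [comp_apply, hFp, hFp, hFp]
      exact congrArg Subtype.val (mul_smul g h p)
  let act : MulAction Γ (Tree m × Tree n) :=
    { smul := F, one_smul := congrFun h1, mul_smul := fun g h => congrFun (hmul g h) }
  exact ⟨act, ⟨hFp, hF⟩⟩

namespace IsLift

variable {Γ : Type*} [Group Γ] {m n : ℕ} [MulAction Γ (DL m n)] [MulAction Γ (Tree m × Tree n)]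

theorem preserves_inv (hm : 0 < m) (hn : 0 < n) (h : IsLift Γ m n) {g : Γ} {e : ℤ}
    (hg : Preserves (fun z : Tree m × Tree n => g • z) e) :
    Preserves (fun z : Tree m × Tree n => g⁻¹ • z) (-e) := by
  obtain ⟨e', h' | h'⟩ := h.preserves_or_reverses g⁻¹
  · obtain ⟨x, -⟩ := Tree.exists_height_eq hm 0
    obtain ⟨p, -⟩ := DL.exists_fst_eq hn x
    have h1 := hg.height_fst p.1
    have h2 := h'.height_fst (g • p.1)
    simp only [inv_smul_smul] at h2
    obtain rfl : e' = -e := by omega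
    exact h'
  · refine (Preserves.id.not_reverses hm hn (h'.comp_preserves hg) fun p => ?_).elim
    simp

theorem reverses_inv (hm : 0 < m) (hn : 0 < n) (h : IsLift Γ m n) {g : Γ} {e : ℤ}
    (hg : Reverses (fun z : Tree m × Tree n => g • z) e) :
    Reverses (fun z : Tree m × Tree n => g⁻¹ • z) e := by
  obtain ⟨e', h' | h'⟩ := h.preserves_or_reverses g⁻¹
  · refine (Preserves.id.not_reverses hm hn (h'.comp_reverses hg) fun p => ?_).elim
    simp
  · obtain ⟨x, -⟩ := Tree.exists_height_eq hm 0
    obtain ⟨p, -⟩ := DL.exists_fst_eq hn x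
    have h1 := hg.height_snd p.1
    have h2 := h'.height_fst (g • p.1)
    simp only [inv_smul_smul] at h2
    obtain rfl : e' = e := by omega
    exact h'

/-- The elements of the group that do not exchange the trees shift the heights by the multiples
of an integer, and those that exchange the trees by the elements of one residue class. -/
theorem exists_shift (hm : 0 < m) (hn : 0 < n) (h : IsLift Γ m n) :
    ∃ (d : ℕ) (e₀ : ℤ),
      (∀ e : ℤ, (∃ g : Γ, Preserves (fun z : Tree m × Tree n => g • z) e) ↔ (d : ℤ) ∣ e) ∧
      ∀ (g : Γ) (e : ℤ), Reverses (fun z : Tree m × Tree n => g • z) e → (d : ℤ) ∣ e - e₀ := by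
  let E : AddSubgroup ℤ :=
    { carrier := {e | ∃ g : Γ, Preserves (fun z : Tree m × Tree n => g • z) e}
      zero_mem' := ⟨1, by simp only [one_smul]; exact Preserves.id⟩
      add_mem' := fun ⟨g, hg⟩ ⟨g', hg'⟩ => ⟨g * g', Preserves.smul_mul hg hg'⟩
      neg_mem' := fun ⟨g, hg⟩ => ⟨g⁻¹, h.preserves_inv hm hn hg⟩ }
  obtain ⟨a, ha⟩ := Int.subgroup_cyclic E
  have hE : ∀ e : ℤ, (∃ g : Γ, Preserves (fun z : Tree m × Tree n => g • z) e) ↔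
      (a.natAbs : ℤ) ∣ e := by
    intro e
    change e ∈ E ↔ _
    rw [ha, ← AddSubgroup.zmultiples_eq_closure, Int.mem_zmultiples_iff, Int.natAbs_dvd]
  by_cases hR : ∃ (g : Γ) (e : ℤ), Reverses (fun z : Tree m × Tree n => g • z) e
  · obtain ⟨g₀, e₀, h₀⟩ := hR
    exact ⟨a.natAbs, e₀, hE, fun g e hg =>
      -- Inverting an exchange keeps its shift, so this product shifts by e - e₀.
      (hE _).1 ⟨g * g₀⁻¹, Reverses.smul_mul hg (h.reverses_inv hm hn h₀)⟩⟩
  · exact ⟨a.natAbs, 0, hE, fun g e hg => (hR ⟨g, e, hg⟩).elim⟩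

end IsLift

/-! ### Cocompactness: nonzero shifts, and transitivity near the ends -/

theorem ActsCocompactly.exists_finite {Γ : Type*} [Group Γ] {m n : ℕ} [MulAction Γ (DL m n)]
    (h : ActsCocompactly Γ m n) :
    ∃ S : Set (DL m n), S.Finite ∧ ∀ p, ∃ s ∈ S, ∃ g : Γ, g • s = p := by
  have : CompactSpace (Quotient (MulAction.orbitRel Γ (DL m n))) := h
  have : DiscreteTopology (Quotient (MulAction.orbitRel Γ (DL m n))) :=
    discreteTopology_iff_forall_isOpen.2 fun s => isOpen_coinduced.2 (isOpen_discrete _)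
  have : Finite (Quotient (MulAction.orbitRel Γ (DL m n))) := finite_of_compact_of_discrete
  let s := MulAction.orbitRel Γ (DL m n)
  refine ⟨Set.range (Quotient.out (s := s)), Set.finite_range _, fun p => ⟨_, ⟨⟦p⟧, rfl⟩, ?_⟩⟩
  exact MulAction.orbitRel_apply.1 (s.symm (Quotient.mk_out p))

theorem Tree.exists_iterate_eq_of_finite {n : ℕ} {S : Set (Tree n)} (hS : S.Finite) {a : ℤ}
    (ha : ∀ x ∈ S, x.height = a) :
    ∃ j : ℕ, ∀ k, j ≤ k → ∀ x ∈ S, ∀ y ∈ S, parent^[k] x = parent^[k] y := by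
  have h1 : ∀ q : Tree n × Tree n, ∃ j, q ∈ S ×ˢ S → parent^[j] q.1 = parent^[j] q.2 := by
    intro q
    by_cases hq : q ∈ S ×ˢ S
    · obtain ⟨j, hj⟩ := exists_iterate_eq_of_height_eq ((ha _ hq.1).trans (ha _ hq.2).symm)
      exact ⟨j, fun _ => hj⟩
    · exact ⟨0, fun h => (hq h).elim⟩
  choose f hf using h1
  obtain ⟨j, hj⟩ := ((hS.prod hS).image f).bddAbove
  refine ⟨j, fun k hk x hx y hy => ?_⟩
  have h2 : f (x, y) ≤ k := (hj ⟨(x, y), ⟨hx, hy⟩, rfl⟩).trans hk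
  rw [← Nat.sub_add_cancel h2, iterate_add_apply, iterate_add_apply, hf (x, y) ⟨hx, hy⟩]

namespace IsLift

variable {Γ : Type*} [Group Γ] {m n : ℕ} [MulAction Γ (DL m n)] [MulAction Γ (Tree m × Tree n)]

/-- If d = 0, the first height takes at most two values on each orbit. Finitely many orbits cannot
account for all integers. -/
theorem shift_ne_zero (hm : 0 < m) (hn : 0 < n) (h : IsLift Γ m n) (hc : ActsCocompactly Γ m n)
    {d : ℕ} {e₀ : ℤ}
    (hd : ∀ e : ℤ, (∃ g : Γ, Preserves (fun z : Tree m × Tree n => g • z) e) ↔ (d : ℤ) ∣ e)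
    (he₀ : ∀ (g : Γ) (e : ℤ), Reverses (fun z : Tree m × Tree n => g • z) e → (d : ℤ) ∣ e - e₀) :
    d ≠ 0 := by
  rintro rfl
  simp only [Nat.cast_zero, zero_dvd_iff, sub_eq_zero] at hd he₀
  obtain ⟨S, hS, hSp⟩ := hc.exists_finite
  have hfin := (hS.image fun p => p.1.1.height).union (hS.image fun p => p.1.2.height + e₀)
  refine Set.infinite_univ (hfin.subset fun k _ => ?_)
  obtain ⟨x, rfl⟩ := Tree.exists_height_eq hm k
  obtain ⟨p, rfl⟩ := DL.exists_fst_eq hn x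
  obtain ⟨s, hs, g, rfl⟩ := hSp p
  rw [← h.smul_coe]
  obtain ⟨e, he | he⟩ := h.preserves_or_reverses g
  · refine Or.inl ⟨s, hs, ?_⟩
    have h1 := he.height_fst s.1
    rw [(hd e).1 ⟨g, he⟩, add_zero] at h1
    exact h1.symm
  · refine Or.inr ⟨s, hs, ?_⟩
    have h1 := he.height_fst s.1
    rw [he₀ g e he] at h1
    exact h1.symm

theorem exists_finite_height_eq_zero (hm : 0 < m) (hn : 0 < n) (h : IsLift Γ m n)
    (hc : ActsCocompactly Γ m n) :
    ∃ S : Set (DL m n), S.Finite ∧ (∀ s ∈ S, s.1.1.height = 0) ∧ ∀ p : DL m n, p.1.1.height = 0 →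
      ∃ s ∈ S, ∃ g : Γ, Preserves (fun z : Tree m × Tree n => g • z) 0 ∧ g • s = p := by
  classical
  obtain ⟨S, hS, hSp⟩ := hc.exists_finite
  choose s hs g hg using hSp
  -- Vertices are classified by their orbit representative and by whether the chosen element
  -- preserves the factors. Two vertices of height 0 in one class differ by an element that
  -- preserves the factors, and its shift is then 0.
  let c : DL m n → DL m n × Prop := fun p =>
    (s p, ∃ e, Preserves (fun z : Tree m × Tree n => g p • z) e)
  have hcS : (c '' {p | p.1.1.height = 0}).Finite := by
    refine (hS.prod (Set.finite_univ (α := Prop))).subset ?_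
    rintro _ ⟨p, -, rfl⟩
    exact ⟨hs p, trivial⟩
  obtain ⟨T, hT, hTc⟩ := Set.exists_subset_bijOn {p : DL m n | p.1.1.height = 0} c
  refine ⟨T, hTc.finite_iff_finite.2 hcS, hT, fun p hp => ?_⟩
  obtain ⟨q, hq, hqp⟩ := hTc.surjOn ⟨p, hp, rfl⟩
  have hq0 : q.1.1.height = 0 := hT hq
  obtain ⟨h1, h2⟩ := Prod.ext_iff.1 hqp
  have h3 : (g p * (g q)⁻¹) • q = p := by
    rw [mul_smul, inv_smul_eq_iff.2 (hg q).symm, show s q = s p from h1, hg]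
  have h4 : ∃ e, Preserves (fun z : Tree m × Tree n => (g p * (g q)⁻¹) • z) e := by
    by_cases h5 : ∃ e, Preserves (fun z : Tree m × Tree n => g q • z) e
    · obtain ⟨e, he⟩ := h5
      obtain ⟨e', he'⟩ := (eq_iff_iff.1 h2).1 ⟨e, he⟩
      exact ⟨_, Preserves.smul_mul he' (h.preserves_inv hm hn he)⟩
    · obtain ⟨e, he⟩ := h.preserves_or_reverses (g q)
      obtain ⟨e', he'⟩ := h.preserves_or_reverses (g p)
      have he := he.resolve_left fun h => h5 ⟨_, h⟩
      have he' := he'.resolve_left fun h => h5 ((eq_iff_iff.1 h2).2 ⟨_, h⟩)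
      exact ⟨_, Reverses.smul_mul he' (h.reverses_inv hm hn he)⟩
  obtain ⟨e, he⟩ := h4
  have h6 := he.height_fst q.1
  simp only [h.smul_coe, h3, hp, hq0] at h6
  obtain rfl : e = 0 := by omega
  exact ⟨q, hq, _, he, h3⟩

/-- The subgroup that preserves the heights is transitive on the products of horospheres that are
close enough to the ends. -/
theorem exists_transitive_on_horospheres (hm : 0 < m) (hn : 0 < n) (h : IsLift Γ m n)
    (hc : ActsCocompactly Γ m n) :
    ∃ j : ℕ, ∀ z w : Tree m × Tree n, z.1.height = w.1.height → z.2.height = w.2.height →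
      z.1.height ≤ -j → z.2.height ≤ -j → ∃ g : Γ, g • z = w := by
  obtain ⟨S, hS, hS0, hSp⟩ := h.exists_finite_height_eq_zero hm hn hc
  obtain ⟨j₁, hj₁⟩ := Tree.exists_iterate_eq_of_finite (hS.image fun s => s.1.1) (a := 0) <| by
    rintro _ ⟨s, hs, rfl⟩
    exact hS0 s hs
  obtain ⟨j₂, hj₂⟩ := Tree.exists_iterate_eq_of_finite (hS.image fun s => s.1.2) (a := 0) <| by
    rintro _ ⟨s, hs, rfl⟩
    have h1 := hS0 s hs
    have h2 := s.2
    simp only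
    omega
  -- Descendants of the coordinates of `z` at height 0 form a vertex of DL(m, n), which can be moved
  -- into `S`. For large k and l the pair of ancestors does not depend on `s`.
  have key : ∀ (k l : ℕ) (z : Tree m × Tree n), z.1.height = -k → z.2.height = -l →
      ∃ s ∈ S, ∃ g : Γ, g • (Tree.parent^[k] s.1.1, Tree.parent^[l] s.1.2) = z := by
    intro k l z hk hl
    obtain ⟨x, hx⟩ := Tree.exists_iterate_parent_eq hm k z.1
    obtain ⟨y, hy⟩ := Tree.exists_iterate_parent_eq hn l z.2
    have h1 := congrArg Tree.height hx
    have h2 := congrArg Tree.height hy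
    rw [Tree.height_iterate] at h1 h2
    obtain ⟨s, hs, g, hg, hgs⟩ := hSp ⟨(x, y), by simp only; omega⟩ (by simp only; omega)
    refine ⟨s, hs, g, (hg.map_iterate_parent k l s.1).trans ?_⟩
    rw [h.smul_coe, hgs, hx, hy]
  refine ⟨max j₁ j₂, fun z w h1 h2 hz1 hz2 => ?_⟩
  obtain ⟨s, hs, g, hg⟩ := key (-z.1.height).toNat (-z.2.height).toNat z (by omega) (by omega)
  obtain ⟨t, ht, g', hg'⟩ := key (-z.1.height).toNat (-z.2.height).toNat w (by omega) (by omega)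
  rw [hj₁ _ (by omega) _ ⟨t, ht, rfl⟩ _ ⟨s, hs, rfl⟩,
    hj₂ _ (by omega) _ ⟨t, ht, rfl⟩ _ ⟨s, hs, rfl⟩] at hg'
  exact ⟨g' * g⁻¹, by rw [mul_smul, inv_smul_eq_iff.2 hg.symm, hg']⟩

theorem exists_transitive (hm : 0 < m) (hn : 0 < n) (h : IsLift Γ m n)
    (hc : ActsCocompactly Γ m n) {d : ℕ} (hd0 : d ≠ 0)
    (hd : ∀ e : ℤ, (∃ g : Γ, Preserves (fun z : Tree m × Tree n => g • z) e) ↔ (d : ℤ) ∣ e) :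
    ∃ J₀ : ℕ, ∀ J : ℕ, J₀ ≤ J → ∀ z w : Tree m × Tree n,
      z.1.height + z.2.height = -J → w.1.height + w.2.height = -J →
      (d : ℤ) ∣ z.1.height → (d : ℤ) ∣ w.1.height → ∃ g : Γ, g • z = w := by
  obtain ⟨j, hj⟩ := h.exists_transitive_on_horospheres hm hn hc
  refine ⟨2 * j + d, fun J hJ z w hz hw hdz hdw => ?_⟩
  -- A multiple of d between -j - d and -j: the first height can be shifted to a, and J ≥ 2j + d
  -- makes the second height -J - a at most -j too.
  let a : ℤ := -d * ((j + d) / d)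
  have ha1 : a ≤ -j := by
    have := Int.lt_mul_ediv_self_add (x := (j + d : ℤ)) (k := d) (by omega)
    simp only [a]
    linarith
  have ha2 : -j - d ≤ a := by
    have := Int.mul_ediv_self_le (x := (j + d : ℤ)) (k := d) (by omega)
    simp only [a]
    linarith
  have ha : (d : ℤ) ∣ a := Dvd.intro _ (neg_mul_comm _ _).symm
  obtain ⟨s, hs⟩ := (hd (a - z.1.height)).2 (dvd_sub ha hdz)
  obtain ⟨t, ht⟩ := (hd (a - w.1.height)).2 (dvd_sub ha hdw)
  have s1 := hs.height_fst z
  have s2 := hs.height_snd z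
  have t1 := ht.height_fst w
  have t2 := ht.height_snd w
  obtain ⟨g, hg⟩ := hj (s • z) (t • w) (by omega) (by omega) (by omega) (by omega)
  exact ⟨t⁻¹ * g * s, by rw [mul_smul, mul_smul, hg, inv_smul_smul]⟩

/-! ### Transporters in T_m × T_n are open, and compact on the levels below DL(m, n) -/

/-- The vertices `p₁` and `p₂` carry the coordinates of `z`, and `p₃` detects an exchange of the
trees: from `p₁` to `p₃` the first height of the image drops by 1 if the factors are preserved, and
rises by 1 if they are exchanged. -/
theorem smul_eq_of_smul_eq (hm : 0 < m) (hn : 0 < n) (h : IsLift Γ m n) (z : Tree m × Tree n) :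
    ∃ p₁ p₂ p₃ : DL m n, ∀ g g' : Γ, g • p₁ = g' • p₁ → g • p₂ = g' • p₂ → g • p₃ = g' • p₃ →
      g • z = g' • z := by
  obtain ⟨p₁, hp₁⟩ := DL.exists_fst_eq hn z.1
  obtain ⟨p₂, hp₂⟩ := DL.exists_snd_eq hm z.2
  obtain ⟨p₃, hp₃⟩ := DL.exists_fst_eq hn (Tree.parent z.1)
  have not_both : ∀ {g g' : Γ} {e e' : ℤ}, Preserves (fun z : Tree m × Tree n => g • z) e →
      Reverses (fun z : Tree m × Tree n => g' • z) e' → g • p₁ = g' • p₁ → g • p₃ = g' • p₃ →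
      False := by
    intro g g' e e' hg hg' h1 h3
    have a1 := hg.height_fst p₁.1
    have a3 := hg.height_fst p₃.1
    have b1 := hg'.height_fst p₁.1
    have b3 := hg'.height_fst p₃.1
    have c1 := p₁.2
    have c3 := p₃.2
    simp only [h.smul_coe, h1, h3, hp₁, hp₃, Tree.height_parent] at a1 a3 b1 b3 c1 c3
    omega
  refine ⟨p₁, p₂, p₃, fun g g' h1 h2 h3 => ?_⟩
  have h1' : g • p₁.1 = g' • p₁.1 := by rw [h.smul_coe, h.smul_coe, h1]
  have h2' : g • p₂.1 = g' • p₂.1 := by rw [h.smul_coe, h.smul_coe, h2]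
  obtain ⟨e, he | he⟩ := h.preserves_or_reverses g <;>
    obtain ⟨e', he' | he'⟩ := h.preserves_or_reverses g'
  · exact Prod.ext
      ((he.fst_congr hp₁.symm).trans ((congrArg Prod.fst h1').trans (he'.fst_congr hp₁)))
      ((he.snd_congr hp₂.symm).trans ((congrArg Prod.snd h2').trans (he'.snd_congr hp₂)))
  · exact (not_both he he' h1 h3).elim
  · exact (not_both he' he h1.symm h3.symm).elim
  · exact Prod.ext
      ((he.fst_congr hp₂.symm).trans ((congrArg Prod.fst h2').trans (he'.fst_congr hp₂)))
      ((he.snd_congr hp₁.symm).trans ((congrArg Prod.snd h1').trans (he'.snd_congr hp₁)))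

/-- Lifting the second coordinate of `z` by J levels gives a vertex `p` of DL(m, n). If `g` moves
`z` to `w`, then `g • p` shares one coordinate with `w`, and its other coordinate is one of the
finitely many descendants of that of `w`, J levels up. -/
theorem exists_finite_smul_mem (hn : 0 < n) (h : IsLift Γ m n) {J : ℕ} {z : Tree m × Tree n}
    (hz : z.1.height + z.2.height = -J) (w : Tree m × Tree n) :
    ∃ (p : DL m n) (Q : Set (DL m n)), Q.Finite ∧ ∀ g : Γ, g • z = w → g • p ∈ Q := by
  obtain ⟨y, hy⟩ := Tree.exists_iterate_parent_eq hn J z.2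
  have h1 := congrArg Tree.height hy
  rw [Tree.height_iterate] at h1
  let p : DL m n := ⟨(z.1, y), by simp only; omega⟩
  have hp : (Tree.parent^[0] p.1.1, Tree.parent^[J] p.1.2) = z := Prod.ext rfl hy
  let A : Set (Tree m × Tree n) := {w.1} ×ˢ {y | Tree.parent^[J] y = w.2}
  let B : Set (Tree m × Tree n) := {x | Tree.parent^[J] x = w.1} ×ˢ {w.2}
  have hAB : (A ∪ B).Finite :=
    ((Set.finite_singleton _).prod (Tree.finite_iterate_parent_fiber J w.2)).union
      ((Tree.finite_iterate_parent_fiber J w.1).prod (Set.finite_singleton _))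
  refine ⟨p, {q | q.1 ∈ A ∪ B}, hAB.preimage Subtype.val_injective.injOn, fun g hg => ?_⟩
  change (g • p).1 ∈ A ∪ B
  rw [← h.smul_coe]
  obtain ⟨e, he | he⟩ := h.preserves_or_reverses g
  · have h2 := he.map_iterate_parent 0 J p.1
    rw [hp, hg] at h2
    exact Or.inl ⟨(congrArg Prod.fst h2).symm, (congrArg Prod.snd h2).symm⟩
  · have h2 := he.map_iterate_parent 0 J p.1
    rw [hp, hg] at h2
    exact Or.inr ⟨(congrArg Prod.fst h2).symm, (congrArg Prod.snd h2).symm⟩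

variable [TopologicalSpace Γ]

theorem isOpen_transporter (hm : 0 < m) (hn : 0 < n) (h : IsLift Γ m n)
    (hp : ProperSMul Γ (DL m n)) (z w : Tree m × Tree n) : IsOpen {g : Γ | g • z = w} := by
  rw [properSMul_iff_of_discreteTopology] at hp
  obtain ⟨p₁, p₂, p₃, hz⟩ := h.smul_eq_of_smul_eq hm hn z
  refine isOpen_iff_forall_mem_open.2 fun g hg => ?_
  refine ⟨{x | x • p₁ = g • p₁} ∩ {x | x • p₂ = g • p₂} ∩ {x | x • p₃ = g • p₃}, ?_,
    (((hp _ _).1.inter (hp _ _).1).inter (hp _ _).1), ⟨⟨rfl, rfl⟩, rfl⟩⟩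
  rintro x ⟨⟨h1, h2⟩, h3⟩
  exact (hz x g h1 h2 h3).trans hg

theorem isCompact_transporter (hm : 0 < m) (hn : 0 < n) (h : IsLift Γ m n)
    (hp : ProperSMul Γ (DL m n)) {J : ℕ} {z : Tree m × Tree n}
    (hz : z.1.height + z.2.height = -J) (w : Tree m × Tree n) : IsCompact {g : Γ | g • z = w} := by
  obtain ⟨p, Q, hQ, hpQ⟩ := h.exists_finite_smul_mem hn hz w
  have hclosed : IsClosed {g : Γ | g • z = w} := by
    have : {g : Γ | g • z = w}ᶜ = ⋃ w' ∈ ({w}ᶜ : Set (Tree m × Tree n)), {g : Γ | g • z = w'} := by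
      ext g
      simp
    rw [← isOpen_compl_iff, this]
    exact isOpen_biUnion fun w' _ => h.isOpen_transporter hm hn hp z w'
  rw [properSMul_iff_of_discreteTopology] at hp
  refine (hQ.isCompact_biUnion fun q _ => (hp p q).2).of_isClosed_subset hclosed fun g hg => ?_
  exact Set.mem_biUnion (hpQ g hg) rfl

end IsLift

/-! ### The copy of DL(m^d, n^d) inside T_m × T_n -/

section coarsen

variable {m n d : ℕ} (hm : 0 < m) (hn : 0 < n) (hd : 0 < d) (J : ℕ)

/-- This identifies `DL(m^d, n^d)` with the set of all `(x, y)` such that the height of `x` is a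
multiple of `d`, and such that the heights of `x` and `y` add up to `-J`. -/
def coarsen (u : DL (m ^ d) (n ^ d)) : Tree m × Tree n :=
  (Tree.expand hm hd 0 u.1.1, Tree.expand hn hd J u.1.2)

theorem coarsen_injective : Injective (coarsen hm hn hd J) := fun _ _ h =>
  Subtype.ext (Prod.ext (Tree.expand_injective hm hd 0 (congrArg Prod.fst h))
    (Tree.expand_injective hn hd J (congrArg Prod.snd h)))

theorem dvd_height_coarsen (u : DL (m ^ d) (n ^ d)) :
    (d : ℤ) ∣ (coarsen hm hn hd J u).1.height := by
  rw [coarsen, Tree.height_expand, sub_zero]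
  exact dvd_mul_right _ _

theorem height_coarsen (u : DL (m ^ d) (n ^ d)) :
    (coarsen hm hn hd J u).1.height + (coarsen hm hn hd J u).2.height = -J := by
  have h : u.1.2.height = -u.1.1.height := by have := u.2; omega
  rw [coarsen, Tree.height_expand, Tree.height_expand, h]
  ring

theorem exists_coarsen_eq (z : Tree m × Tree n) (hz : z.1.height + z.2.height = -J)
    (hdz : (d : ℤ) ∣ z.1.height) : ∃ u, coarsen hm hn hd J u = z := by
  obtain ⟨x, hx⟩ := Tree.exists_expand_eq hm hd 0 z.1 (by rwa [add_zero])
  obtain ⟨y, hy⟩ := Tree.exists_expand_eq hn hd J z.2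
    (by rwa [show z.2.height + J = -z.1.height by omega, dvd_neg])
  refine ⟨⟨(x, y), ?_⟩, Prod.ext hx hy⟩
  rw [← hx, ← hy, Tree.height_expand, Tree.height_expand] at hz
  have h1 : (d : ℤ) * (x.height + y.height) = 0 := by linarith
  exact (mul_eq_zero.1 h1).resolve_left (by omega)

/-- `w` is obtained from `z` by `d` steps away from the end of `T_m` and towards the end of
`T_n`. -/
def Climbs {m n : ℕ} (d : ℕ) (z w : Tree m × Tree n) : Prop :=
  Tree.parent^[d] w.1 = z.1 ∧ Tree.parent^[d] z.2 = w.2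

theorem climbs_coarsen_iff {u v : DL (m ^ d) (n ^ d)} :
    Climbs d (coarsen hm hn hd J u) (coarsen hm hn hd J v) ↔ DL.Up u v := by
  simp only [Climbs, coarsen, Tree.iterate_parent_expand, (Tree.expand_injective hm hd 0).eq_iff,
    (Tree.expand_injective hn hd J).eq_iff, DL.Up]

end coarsen

theorem Preserves.climbs {m n m' n' : ℕ} {f : Tree m × Tree n → Tree m' × Tree n'} {e : ℤ}
    (h : Preserves f e) {d : ℕ} {z w : Tree m × Tree n} (hzw : Climbs d z w) :
    Climbs d (f z) (f w) := by
  obtain ⟨α, β, hα, hβ, -, -, rfl⟩ := h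
  exact ⟨((hα.iterate_right d).eq w.1).symm.trans (congrArg α hzw.1),
    ((hβ.iterate_right d).eq z.2).symm.trans (congrArg β hzw.2)⟩

theorem Reverses.climbs {m n m' n' : ℕ} {f : Tree m × Tree n → Tree m' × Tree n'} {e : ℤ}
    (h : Reverses f e) {d : ℕ} {z w : Tree m × Tree n} (hzw : Climbs d z w) :
    Climbs d (f w) (f z) :=
  Preserves.climbs h (z := w.swap) (w := z.swap) ⟨hzw.2, hzw.1⟩

theorem IsLift.exists_coarsen_eq_smul {Γ : Type*} [Group Γ] {m n : ℕ} [MulAction Γ (DL m n)]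
    [MulAction Γ (Tree m × Tree n)] (hm : 0 < m) (hn : 0 < n) (h : IsLift Γ m n)
    {d J : ℕ} (hd0 : 0 < d)
    (hd : ∀ e : ℤ, (∃ g : Γ, Preserves (fun z : Tree m × Tree n => g • z) e) ↔ (d : ℤ) ∣ e)
    (hJ : ∀ (g : Γ) (e : ℤ), Reverses (fun z : Tree m × Tree n => g • z) e → (d : ℤ) ∣ e - J)
    (g : Γ) (u : DL (m ^ d) (n ^ d)) :
    ∃ v, coarsen hm hn hd0 J v = g • coarsen hm hn hd0 J u := by
  have h1 := dvd_height_coarsen hm hn hd0 J u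
  have h2 := height_coarsen hm hn hd0 J u
  generalize coarsen hm hn hd0 J u = z at h1 h2
  obtain ⟨e, he | he⟩ := h.preserves_or_reverses g
  · have e1 := he.height_fst z
    have e2 := he.height_snd z
    refine exists_coarsen_eq hm hn hd0 J _ (by omega) ?_
    rw [e1]
    exact dvd_add h1 ((hd e).1 ⟨g, he⟩)
  · have e1 := he.height_fst z
    have e2 := he.height_snd z
    refine exists_coarsen_eq hm hn hd0 J _ (by omega) ?_
    -- An exchange replaces the first height h by e - J - h, which is why J has to lie in the class
    -- of e modulo d.
    rw [e1, show z.2.height + e = e - J - z.1.height by omega]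
    exact dvd_sub (hJ g e he) h1

end DiestelLeader

/-! ### The transitive action -/

open DiestelLeader in
theorem mainTheorem2 (m n : ℕ) (hm : 2 ≤ m) (hn : 2 ≤ n)
    (Γ : Type*) [Group Γ] [TopologicalSpace Γ] [IsTopologicalGroup Γ] [LocallyCompactSpace Γ]
    [MulAction Γ (DiestelLeader.DL m n)]
    (hauto : DiestelLeader.ActsByAutomorphisms Γ m n)
    (hproper : ProperSMul Γ (DiestelLeader.DL m n))
    (hcocompact : DiestelLeader.ActsCocompactly Γ m n) :
    ∃ d : ℕ, 0 < d ∧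
      ∃ _ : MulAction Γ (DiestelLeader.DL (m ^ d) (n ^ d)),
        DiestelLeader.ActsByAutomorphisms Γ (m ^ d) (n ^ d) ∧
        ProperSMul Γ (DiestelLeader.DL (m ^ d) (n ^ d)) ∧
        MulAction.IsPretransitive Γ (DiestelLeader.DL (m ^ d) (n ^ d)) := by
  have hm' : 0 < m := by omega
  have hn' : 0 < n := by omega
  obtain ⟨_, hlift⟩ := exists_isLift hm hn hauto
  obtain ⟨d, e₀, hd, he₀⟩ := hlift.exists_shift hm' hn'
  have hd0 : d ≠ 0 := hlift.shift_ne_zero hm' hn' hcocompact hd he₀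
  have hdpos : 0 < d := Nat.pos_of_ne_zero hd0
  obtain ⟨J₀, hJ₀⟩ := hlift.exists_transitive hm' hn' hcocompact hd0 hd
  -- J is large enough for transitivity, and congruent to e₀ so that exchanges preserve the image of
  -- `coarsen`.
  obtain ⟨J, hJ, hJe⟩ : ∃ J : ℕ, J₀ ≤ J ∧ (d : ℤ) ∣ e₀ - J := by
    have h1 := Int.emod_nonneg (e₀ - J₀) (b := d) (by omega)
    refine ⟨J₀ + ((e₀ - J₀) % d).toNat, by omega, ?_⟩
    rw [Nat.cast_add, Int.toNat_of_nonneg h1, ← sub_sub]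
    exact Int.dvd_self_sub_emod
  have hJR : ∀ (g : Γ) (e : ℤ), Reverses (fun z : Tree m × Tree n => g • z) e →
      (d : ℤ) ∣ e - J := by
    intro g e he
    have := dvd_add (he₀ g e he) hJe
    rwa [sub_add_sub_cancel] at this
  let E := coarsen hm' hn' hdpos J
  have hE : Function.Injective E := coarsen_injective hm' hn' hdpos J
  choose act hact using hlift.exists_coarsen_eq_smul hm' hn' hdpos hd hJR
  let _ : SMul Γ (DL (m ^ d) (n ^ d)) := ⟨act⟩
  have hsmul : ∀ (g : Γ) u, E (g • u) = g • E u := hact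
  let inst : MulAction Γ (DL (m ^ d) (n ^ d)) := hE.mulAction E hsmul
  have hadj : ∀ (g : Γ) (u v : DL (m ^ d) (n ^ d)),
      (DL.graph (m ^ d) (n ^ d)).Adj u v → (DL.graph (m ^ d) (n ^ d)).Adj (g • u) (g • v) := by
    intro g u v
    simp only [DL.adj_iff, ← climbs_coarsen_iff hm' hn' hdpos J]
    change Climbs d (E u) (E v) ∨ Climbs d (E v) (E u) →
      Climbs d (E (g • u)) (E (g • v)) ∨ Climbs d (E (g • v)) (E (g • u))
    rw [hsmul, hsmul]
    obtain ⟨e, he | he⟩ := hlift.preserves_or_reverses g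
    · exact Or.imp he.climbs he.climbs
    · exact fun h => (Or.imp he.climbs he.climbs h).symm
  refine ⟨d, hdpos, inst, fun g u v => ⟨fun h => ?_, hadj g u v⟩, ?_, ⟨fun u v => ?_⟩⟩
  -- The converse is preservation of adjacency by the inverse element.
  · simpa only [inv_smul_smul] using hadj g⁻¹ _ _ h
  · refine properSMul_iff_of_discreteTopology.2 fun u v => ?_
    have h1 : {g : Γ | g • u = v} = {g : Γ | g • E u = E v} := by
      ext g
      exact hE.eq_iff.symm.trans (by rw [hsmul]; rfl)
    rw [h1]
    exact ⟨hlift.isOpen_transporter hm' hn' hproper _ _,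
      hlift.isCompact_transporter hm' hn' hproper (height_coarsen hm' hn' hdpos J u) _⟩
  · obtain ⟨g, hg⟩ := hJ₀ J hJ (E u) (E v) (height_coarsen _ _ _ _ u) (height_coarsen _ _ _ _ v)
      (dvd_height_coarsen _ _ _ _ u) (dvd_height_coarsen _ _ _ _ v)
    exact ⟨g, hE ((hsmul g u).trans hg)⟩
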